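/- Let $m=(m_{s,t})_{s,t\in B}$ be a Coxeter matrix over an arbitrary set $B$ (so $m_{s,s}=1$ and $m_{s,t}=m_{t,s}\in\{2,3,\dots\}\cup\{\infty\}$ for $s\ne t$), and let $M$ be the associated Artin–Tits monoid, that is, the monoid generated by $B$ subject to the relations $sts\cdots=tst\cdots$ (alternating words of length $m_{s,t}$ on both sides) for all $s\neq t$ with $m_{s,t}<\infty$. For $f,g\in M$, write $f\preceq g$ if $g=fg'$ for some $g'\in M$ ($f$ is a left-divisor of $g$, and $g$ is a right-multiple of $f$), and call $f$ a right-divisor of $g$ if $g=g'f$ for some $g'\in M$. An atom of $M$ is an element $g\neq 1$ whose only left-divisors are $1$ and $g$; let $S$ be the set of atoms of $M$. A right-lcm of $f$ and $g$ is a common right-multiple $h$ of $f$ and $g$ such that $h\preceq k$ for every common right-multiple $k$ of $f$ and $g$. A Garside family of $M$ is a subset $F\subseteq M$ containing $1$ such that every $g\in M$ can be written $g=s_1\cdots s_p$ with $s_1,\dots,s_p\in F$ such that, for every $i<p$, all $s\in F$ and all $f\in M$, if $s\preceq f s_i s_{i+1}$ then $s\preceq f s_i$. Then $M$ admits a finite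 Garside family if and only if the closure of $S$ under right-lcm and right-divisor is finite. Here this closure is the smallest subset of $M$ that contains $S$, contains the right-lcm of any two of its elements whenever this right-lcm exists, and contains every right-divisor of each of its elements. -/

import Mathlib

/-- The defining relations of the Artin–Tits monoid of a Coxeter matrix: for generators `s`, `t`
with `m s t` finite (Mathlib encodes `m s t = ∞` by the entry `0`), the two alternating words in
`s` and `t` of length `m s t` are identified. For `s = t` the relation is trivial. -/
inductive CoxeterMatrix.ArtinTitsRel {B : Type*} (m : CoxeterMatrix B) :
    FreeMonoid B → FreeMonoid B → Prop
  | braid (s t : B) (h : m s t ≠ 0) :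
      CoxeterMatrix.ArtinTitsRel m
        (FreeMonoid.ofList (CoxeterSystem.alternatingWord s t (m s t)))
        (FreeMonoid.ofList (CoxeterSystem.alternatingWord t s (m s t)))

/-- The Artin–Tits monoid associated with a Coxeter matrix. -/
abbrev CoxeterMatrix.ArtinTitsMonoid {B : Type*} (m : CoxeterMatrix B) : Type _ :=
  PresentedMonoid m.ArtinTitsRel

namespace Garside

variable {M : Type*} [Monoid M]

/-! In a possibly noncommutative monoid, `f ∣ g` means `∃ c, g = f * c`, so it is left-divisibility:
`f` left-divides `g`, and `g` is a right-multiple of `f`. -/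

/-- `f` is a right-divisor of `g`. -/
def RightDvd (f g : M) : Prop := ∃ g' : M, g = g' * f

/-- An atom: an element other than `1` whose only left-divisors are `1` and itself. -/
def IsMonoidAtom (g : M) : Prop := g ≠ 1 ∧ ∀ f : M, f ∣ g → f = 1 ∨ f = g

variable (M) in
/-- The set of atoms of a monoid. -/
def atoms : Set M := {g | IsMonoidAtom g}

/-- `h` is a right-lcm (least common right-multiple) of `f` and `g`. -/
def IsRightLcm (f g h : M) : Prop :=
  f ∣ h ∧ g ∣ h ∧ ∀ k : M, f ∣ k → g ∣ k → h ∣ k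

/-- `F` contains the right-lcm of any two of its elements whenever that right-lcm exists. -/
def ClosedUnderRightLcm (F : Set M) : Prop :=
  ∀ f ∈ F, ∀ g ∈ F, ∀ h : M, IsRightLcm f g h → h ∈ F

/-- `F` contains every right-divisor of each of its elements. -/
def ClosedUnderRightDivisor (F : Set M) : Prop :=
  ∀ g ∈ F, ∀ f : M, RightDvd f g → f ∈ F

/-- The closure of `X` under right-lcm and right-divisor: the smallest set that contains `X` and is
closed under both. -/
def rightClosure (X : Set M) : Set M :=
  ⋂₀ {F : Set M | X ⊆ F ∧ ClosedUnderRightLcm F ∧ ClosedUnderRightDivisor F}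

/-- The condition on two consecutive entries `a`, `b` of an `F`-normal sequence. -/
def IsGreedyPair (F : Set M) (a b : M) : Prop :=
  ∀ s ∈ F, ∀ f : M, s ∣ f * a * b → s ∣ f * a

/-- The finite sequence `l` is an `F`-normal decomposition of `g`: its product is `g`, all its
entries lie in `F`, and any two consecutive entries form a greedy pair. -/
def IsNormalDecomposition (F : Set M) (g : M) (l : List M) : Prop :=
  l.prod = g ∧ (∀ s ∈ l, s ∈ F) ∧ l.IsChain (IsGreedyPair F)

/-- A Garside family of a (left-cancellative monoid without nontrivial invertible elements) `M`:
a set containing `1` such that every element of `M` has a normal decomposition. -/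
def IsGarsideFamily (F : Set M) : Prop :=
  1 ∈ F ∧ ∀ g : M, ∃ l : List M, IsNormalDecomposition F g l

end Garside

/-! Every Garside family contains the closure of the atoms, and that closure, if finite, becomes a
Garside family once `1` is added.

In a normal decomposition, every element of `F` that left-divides the product already left-divides
the first entry (`dvd_mul_of_isChain`). Hence an atom, a right-lcm or a right-divisor coming from
`F` occurs as an entry of its own decomposition, and so lies in `F`. Conversely, normal
decompositions arise by repeatedly splitting off the greatest left-divisor in the finite set;
`dvd_mul_of_forall_dvd` supplies greediness.

This requires left cancellation, antisymmetry of divisibility and conditional right-lcms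
(`exists_isRightLcm`). Length gives antisymmetry; the rest comes from the Coxeter group `W`. The
signs of images of simple roots detect descents (`reflectionRep_nonneg` and its converse), so two
distinct descents force a braid word. This yields Matsumoto's theorem, hence a lift of `W` to the
monoid. The monoid then acts on pairs `(w, g)`, absorbing into the head as much of `w` as possible
(`headHom`). The image of `(1, 1)` is a head-tail factorization, from which left cancellation and
the lcms of generators are read off. -/

/-! ### The reflection representation and descents in Coxeter groups -/

/-- The sequence `0, 1, 2 * c, …`, whose `k`-th term is `sin (k θ) / sin θ` when `c = cos θ`. -/
def dihedralCoeff (c : ℝ) : ℕ → ℝ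
  | 0 => 0
  | 1 => 1
  | k + 2 => 2 * c * dihedralCoeff c (k + 1) - dihedralCoeff c k

theorem dihedralCoeff_add_two (c : ℝ) (k : ℕ) :
    dihedralCoeff c (k + 2) = 2 * c * dihedralCoeff c (k + 1) - dihedralCoeff c k := rfl

theorem dihedralCoeff_cos_mul_sin (θ : ℝ) (k : ℕ) :
    dihedralCoeff (Real.cos θ) k * Real.sin θ = Real.sin (k * θ) := by
  induction k using Nat.twoStepInduction with
  | zero => simp [dihedralCoeff]
  | one => simp [dihedralCoeff]
  | more k ih₀ ih₁ =>
    have h₀ : ((k + 2 : ℕ) : ℝ) * θ = ((k + 1 : ℕ) : ℝ) * θ + θ := by push_cast; ring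
    have h₁ : (k : ℝ) * θ = ((k + 1 : ℕ) : ℝ) * θ - θ := by push_cast; ring
    rw [dihedralCoeff_add_two, sub_mul, mul_assoc, ih₀, ih₁, h₀, h₁, Real.sin_add, Real.sin_sub]
    ring

theorem dihedralCoeff_one (k : ℕ) : dihedralCoeff 1 k = k := by
  induction k using Nat.twoStepInduction with
  | zero => simp [dihedralCoeff]
  | one => simp [dihedralCoeff]
  | more k ih₀ ih₁ =>
    rw [dihedralCoeff_add_two, ih₀, ih₁]
    push_cast
    ring

theorem Real.sin_pi_div_natCast_pos {n : ℕ} (hn : 2 ≤ n) : 0 < Real.sin (Real.pi / n) := by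
  have hn' : (2 : ℝ) ≤ n := by exact_mod_cast hn
  apply Real.sin_pos_of_pos_of_lt_pi (by positivity)
  rw [div_lt_iff₀ (by linarith)]
  nlinarith [Real.pi_pos]

/-- The coefficient is `sin (kπ/n) / sin (π/n)`. The entry `n = 0` encodes infinity: there `π / 0 =
0`, the cosine is `1` and the coefficient is `k`. -/
theorem dihedralCoeff_nonneg {n k : ℕ} (hn : n ≠ 1) (hk : n ≠ 0 → k ≤ n) :
    0 ≤ dihedralCoeff (Real.cos (Real.pi / n)) k := by
  rcases Nat.eq_zero_or_pos n with rfl | hpos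
  · simp [dihedralCoeff_one]
  · have hs := Real.sin_pi_div_natCast_pos (n := n) (by omega)
    have hn' : (0 : ℝ) < n := by exact_mod_cast hpos
    have hk' : (k : ℝ) ≤ n := by exact_mod_cast hk hpos.ne'
    refine nonneg_of_mul_nonneg_left ?_ hs
    rw [dihedralCoeff_cos_mul_sin]
    apply Real.sin_nonneg_of_nonneg_of_le_pi (by positivity)
    rw [mul_div_assoc', div_le_iff₀ hn', mul_comm]
    exact mul_le_mul_of_nonneg_left hk' Real.pi_pos.le

/-! ### Products of two reflections -/

section Reflection

variable {V : Type*} [AddCommGroup V] [Module ℝ V] {x y : V} {f g : Module.Dual ℝ V} {c : ℝ}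

theorem reflection_mul_reflection_pow_apply_left (hf : f x = 2) (hg : g y = 2)
    (hfy : f y = -2 * c) (hgx : g x = -2 * c) (k : ℕ) :
    ((Module.reflection hf * Module.reflection hg) ^ k) x =
      dihedralCoeff c (2 * k + 1) • x + dihedralCoeff c (2 * k) • y := by
  induction k with
  | zero => simp [dihedralCoeff]
  | succ k ih =>
    rw [pow_succ', LinearEquiv.mul_apply, ih, show 2 * (k + 1) = 2 * k + 2 by ring,
      dihedralCoeff_add_two c (2 * k + 1), dihedralCoeff_add_two c (2 * k)]
    simp only [LinearEquiv.mul_apply, Module.reflection_apply, map_add, map_sub, map_smul, hf, hg,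
      hfy, hgx]
    module

theorem reflection_mul_reflection_pow_succ_apply_right (hf : f x = 2) (hg : g y = 2)
    (hfy : f y = -2 * c) (hgx : g x = -2 * c) (k : ℕ) :
    ((Module.reflection hf * Module.reflection hg) ^ (k + 1)) y =
      -(dihedralCoeff c (2 * k + 2) • x + dihedralCoeff c (2 * k + 1) • y) := by
  induction k with
  | zero =>
    simp only [zero_add, pow_one, LinearEquiv.mul_apply, Module.reflection_apply, map_sub,
      map_smul, hg, hfy, dihedralCoeff]
    module
  | succ k ih =>
    rw [pow_succ', LinearEquiv.mul_apply, ih, show 2 * (k + 1) = 2 * k + 2 by ring,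
      dihedralCoeff_add_two c (2 * k + 2), dihedralCoeff_add_two c (2 * k + 1)]
    simp only [LinearEquiv.mul_apply, Module.reflection_apply, map_add, map_sub, map_neg, map_smul,
      hf, hg, hfy, hgx]
    module

/-- The product rotates the plane of `x` and `y` by `2π/n` and fixes the common kernel of `f` and
`g`, which is a complement because `cos² ≠ 1`. -/
theorem reflection_mul_reflection_pow_eq_one {n : ℕ} (hn : 2 ≤ n) (hf : f x = 2) (hg : g y = 2)
    (hfy : f y = -2 * Real.cos (Real.pi / n)) (hgx : g x = -2 * Real.cos (Real.pi / n)) :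
    (Module.reflection hf * Module.reflection hg) ^ n = 1 := by
  have hs := Real.sin_pi_div_natCast_pos hn
  have hn' : (n : ℝ) ≠ 0 := by positivity
  set θ := Real.pi / n with hθ
  have hnθ : n * θ = Real.pi := by rw [hθ]; field_simp
  have h₀ : dihedralCoeff (Real.cos θ) (2 * n) = 0 := by
    apply mul_right_cancel₀ hs.ne'
    rw [dihedralCoeff_cos_mul_sin, zero_mul]
    push_cast
    rw [mul_assoc, hnθ, Real.sin_two_pi]
  have h₁ : dihedralCoeff (Real.cos θ) (2 * n + 1) = 1 := by
    apply mul_right_cancel₀ hs.ne'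
    rw [dihedralCoeff_cos_mul_sin, one_mul]
    push_cast
    rw [add_mul, mul_assoc, hnθ, one_mul, add_comm, Real.sin_add_two_pi]
  obtain ⟨k, rfl⟩ : ∃ k, n = k + 1 := ⟨n - 1, by omega⟩
  have h₂ : dihedralCoeff (Real.cos θ) (2 * k + 1) = -1 := by
    have h₃ := dihedralCoeff_add_two (Real.cos θ) (2 * k + 1)
    rw [show 2 * k + 1 + 2 = 2 * (k + 1) + 1 by ring, show 2 * k + 1 + 1 = 2 * (k + 1) by ring,
      h₀, h₁] at h₃
    linarith
  have hx := reflection_mul_reflection_pow_apply_left hf hg hfy hgx (k + 1)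
  have hy := reflection_mul_reflection_pow_succ_apply_right hf hg hfy hgx k
  rw [h₀, h₁] at hx
  rw [show 2 * k + 2 = 2 * (k + 1) by ring, h₀, h₂] at hy
  have hfix : ∀ z, f z = 0 → g z = 0 →
      ∀ j : ℕ, ((Module.reflection hf * Module.reflection hg) ^ j) z = z := by
    intro z hz hz' j
    induction j with
    | zero => simp
    | succ j ih =>
      rw [pow_succ', LinearEquiv.mul_apply, ih, LinearEquiv.mul_apply]
      simp [Module.reflection_apply, hz, hz']
  have hc : 1 - Real.cos θ ^ 2 ≠ 0 := by
    rw [← Real.sin_sq]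
    positivity
  ext z
  -- `a` and `b` solve the 2 × 2 system saying that `z - a • x - b • y` is killed by `f` and `g`.
  obtain ⟨a, ha⟩ : ∃ a, a = (f z + Real.cos θ * g z) / (2 * (1 - Real.cos θ ^ 2)) := ⟨_, rfl⟩
  obtain ⟨b, hb⟩ : ∃ b, b = (g z + Real.cos θ * f z) / (2 * (1 - Real.cos θ ^ 2)) := ⟨_, rfl⟩
  have hz := hfix (z - a • x - b • y)
    (by simp only [map_sub, map_smul, hf, hfy, smul_eq_mul, ha, hb]; field_simp; ring)
    (by simp only [map_sub, map_smul, hg, hgx, smul_eq_mul, ha, hb]; field_simp; ring) (k + 1)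
  simp only [map_sub, map_smul, hx, hy] at hz
  simp only [LinearEquiv.coe_one, id]
  linear_combination (norm := module) hz

end Reflection

/-! ### Sign of roots, descents and braid words -/

namespace CoxeterSystem

open Real

variable {B : Type*}

/-- The linear form on `B →₀ ℝ` pairing with twice the simple root `i` under the standard
bilinear form of a Coxeter matrix. -/
noncomputable def simpleCoroot (M : CoxeterMatrix B) (i : B) : Module.Dual ℝ (B →₀ ℝ) :=
  Finsupp.linearCombination ℝ fun j ↦ -2 * cos (π / M i j)

theorem simpleCoroot_single (M : CoxeterMatrix B) (i j : B) :
    simpleCoroot M i (Finsupp.single j 1) = -2 * cos (π / M i j) := by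
  simp [simpleCoroot]

theorem simpleCoroot_single_self (M : CoxeterMatrix B) (i : B) :
    simpleCoroot M i (Finsupp.single i 1) = 2 := by
  simp [simpleCoroot]

theorem two_le_of_ne (M : CoxeterMatrix B) {i j : B} (hij : i ≠ j) (h : M i j ≠ 0) : 2 ≤ M i j := by
  have := M.off_diagonal i j hij
  omega

variable {W : Type*} [Group W] {M : CoxeterMatrix B} (cs : CoxeterSystem M W)

/-- The reflection representation of a Coxeter system. -/
noncomputable def reflectionRep : W →* ((B →₀ ℝ) ≃ₗ[ℝ] (B →₀ ℝ)) :=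
  cs.lift ⟨fun i ↦ Module.reflection (simpleCoroot_single_self M i), by
    intro i j
    rcases eq_or_ne i j with rfl | hij
    · ext1 x
      simp [LinearEquiv.mul_apply, Module.involutive_reflection _ x]
    · rcases eq_or_ne (M i j) 0 with h | h
      · simp [h]
      · exact reflection_mul_reflection_pow_eq_one (two_le_of_ne M hij h) _ _
          (simpleCoroot_single M i j) (by rw [simpleCoroot_single, M.symmetric])⟩

theorem reflectionRep_simple (i : B) :
    cs.reflectionRep (cs.simple i) = Module.reflection (simpleCoroot_single_self M i) :=
  cs.lift_apply_simple _ i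

theorem reflectionRep_simple_apply_self (i : B) :
    cs.reflectionRep (cs.simple i) (Finsupp.single i 1) = -Finsupp.single i 1 := by
  rw [reflectionRep_simple, Module.reflection_apply_self]

/-- An alternating word in `i` and `j` that ends with `j` and is shorter than `M i j` sends the
`i`-th simple root to a nonnegative combination of the `i`-th and `j`-th simple roots. -/
theorem exists_reflectionRep_alternatingWord_apply {i j : B} (hij : i ≠ j) {k : ℕ}
    (hk : M i j ≠ 0 → k < M i j) :
    ∃ a b : ℝ, 0 ≤ a ∧ 0 ≤ b ∧
      cs.reflectionRep (cs.wordProd (alternatingWord i j k)) (Finsupp.single i 1) =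
        a • Finsupp.single i 1 + b • Finsupp.single j 1 := by
  have hgx : simpleCoroot M j (Finsupp.single i 1) = -2 * cos (π / M i j) := by
    rw [simpleCoroot_single, M.symmetric]
  have key (l : ℕ) := reflection_mul_reflection_pow_apply_left (simpleCoroot_single_self M i)
    (simpleCoroot_single_self M j) (simpleCoroot_single M i j) hgx l
  have hpos (l : ℕ) (hl : M i j ≠ 0 → l ≤ M i j) :=
    dihedralCoeff_nonneg (M.off_diagonal i j hij) hl
  rw [prod_alternatingWord_eq_mul_pow]
  obtain ⟨l, rfl | rfl⟩ := Nat.even_or_odd' k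
  · refine ⟨_, _, hpos (2 * l + 1) (fun h ↦ by have := hk h; omega),
      hpos (2 * l) (fun h ↦ by have := hk h; omega), ?_⟩
    simp only [even_two, Even.mul_right, if_true, one_mul, map_pow, map_mul, reflectionRep_simple]
    rw [Nat.mul_div_cancel_left _ two_pos, key]
  · refine ⟨_, _, hpos (2 * l + 1) (fun h ↦ by have := hk h; omega),
      hpos (2 * l + 2) (fun h ↦ by have := hk h; omega), ?_⟩
    have hodd : ¬Even (2 * l + 1) := by simp
    rw [if_neg hodd, show (2 * l + 1) / 2 = l by omega]
    simp only [map_pow, map_mul, reflectionRep_simple]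
    rw [LinearEquiv.mul_apply, key, dihedralCoeff_add_two]
    simp only [Module.reflection_apply, map_add, map_smul, hgx, simpleCoroot_single_self]
    module

theorem wordProd_alternatingWord_succ (i j : B) (k : ℕ) :
    cs.wordProd (alternatingWord i j (k + 1)) =
      cs.wordProd (alternatingWord j i k) * cs.simple j := by
  rw [alternatingWord_succ, wordProd_concat]

theorem length_wordProd_alternatingWord_le (i j : B) (k : ℕ) :
    cs.length (cs.wordProd (alternatingWord i j k)) ≤ k := by
  simpa using cs.length_wordProd_le (alternatingWord i j k)

theorem length_mul_wordProd_alternatingWord_le (v : W) (i j : B) (k : ℕ) :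
    cs.length (v * cs.wordProd (alternatingWord i j k)) ≤ cs.length v + k :=
  (cs.length_mul_le _ _).trans
    (Nat.add_le_add_left (cs.length_wordProd_alternatingWord_le i j k) _)

/-- Every element is the product, with additive lengths, of an element without right descents `i`
and `j` and an alternating word in `i` and `j`. -/
theorem exists_eq_mul_alternatingWord (w : W) (i j : B) :
    ∃ (v : W) (x y : B) (k : ℕ), (x = i ∧ y = j ∨ x = j ∧ y = i) ∧
      w = v * cs.wordProd (alternatingWord x y k) ∧ cs.length w = cs.length v + k ∧
      ¬cs.IsRightDescent v i ∧ ¬cs.IsRightDescent v j := by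
  induction hn : cs.length w using Nat.strong_induction_on generalizing w with
  | _ n ih =>
    subst hn
    by_cases h : cs.IsRightDescent w i ∨ cs.IsRightDescent w j
    · obtain ⟨r, r', hr, hd⟩ : ∃ r r', (r' = i ∧ r = j ∨ r' = j ∧ r = i) ∧
          cs.IsRightDescent w r := by
        rcases h with h | h
        · exact ⟨i, j, by simp, h⟩
        · exact ⟨j, i, by simp, h⟩
      have hlen := cs.isRightDescent_iff.mp hd
      obtain ⟨v, x, y, k, hxy, hw, hl, hvi, hvj⟩ := ih _ hd (w * cs.simple r) rfl
      have hw' : w = v * cs.wordProd (alternatingWord x y k) * cs.simple r := by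
        rw [← hw, simple_mul_simple_cancel_right]
      rcases k with _ | k
      · refine ⟨v, r', r, 1, hr, ?_, by omega, hvi, hvj⟩
        rw [hw', wordProd_alternatingWord_succ]
        simp [alternatingWord]
      -- If the word for `w * s_r` ended in `r`, its last letter would cancel, making `w` shorter
      -- than `w * s_r`.
      · by_cases hyr : y = r
        · exfalso
          subst hyr
          rw [wordProd_alternatingWord_succ, ← mul_assoc, simple_mul_simple_cancel_right] at hw'
          have := cs.length_mul_wordProd_alternatingWord_le v y x k
          rw [← hw'] at this
          omega
        · have hxr : x = r := by grind
          subst hxr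
          refine ⟨v, y, x, k + 2, by tauto, ?_, by omega, hvi, hvj⟩
          rw [hw', wordProd_alternatingWord_succ cs y, mul_assoc]
    · push Not at h
      exact ⟨w, i, j, 0, by simp, by simp [alternatingWord], by simp, h.1, h.2⟩

theorem wordProd_alternatingWord_swap (i j : B) :
    cs.wordProd (alternatingWord i j (M i j)) = cs.wordProd (alternatingWord j i (M i j)) := by
  have := cs.wordProd_braidWord_eq i j
  rwa [braidWord, braidWord, M.symmetric j i] at this

theorem le_of_length_mul_wordProd_alternatingWord {i j : B} {v : W} {k : ℕ}
    (h : cs.length (v * cs.wordProd (alternatingWord i j k)) = cs.length v + k) (hM : M i j ≠ 0) :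
    k ≤ M i j := by
  by_contra! hk
  apply cs.not_isReduced_alternatingWord i j hM hk
  have h₁ := cs.length_mul_le v (cs.wordProd (alternatingWord i j k))
  have h₂ := cs.length_wordProd_alternatingWord_le i j k
  rw [IsReduced, length_alternatingWord]
  omega

/-- Induction on length: with `j` a right descent of `w`, split off the maximal alternating suffix
in `i` and `j`. It sends the root of `i` to a nonnegative combination of two simple roots, to which
the shorter remaining factor applies. -/
theorem reflectionRep_nonneg {w : W} {i : B} (h : ¬cs.IsRightDescent w i) :
    0 ≤ cs.reflectionRep w (Finsupp.single i 1) := by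
  induction hn : cs.length w using Nat.strong_induction_on generalizing w i with
  | _ n ih =>
    subst hn
    rcases eq_or_ne w 1 with rfl | hw
    · simp
    obtain ⟨j, hj⟩ := cs.exists_rightDescent_of_ne_one hw
    have hij : i ≠ j := by rintro rfl; exact h hj
    obtain ⟨v, x, y, k, hxy, rfl, hl, hvi, hvj⟩ := cs.exists_eq_mul_alternatingWord w i j
    have hwi := cs.not_isRightDescent_iff.mp h
    rcases k with _ | k
    · simp [alternatingWord] at hj
      exact absurd hj hvj
    -- The suffix cannot be rewritten to end in `i`, since `i` is not a descent. This also excludes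
    -- the full braid word, so its length is strictly below `M i j`.
    have aux (z : B) (hz : v * cs.wordProd (alternatingWord x y (k + 1)) =
        v * cs.wordProd (alternatingWord z i (k + 1))) : False := by
      rw [hz, wordProd_alternatingWord_succ, ← mul_assoc, simple_mul_simple_cancel_right,
        mul_assoc] at hwi
      have h₁ := cs.length_mul_wordProd_alternatingWord_le v i z k
      rw [hz, wordProd_alternatingWord_succ] at hl
      omega
    obtain ⟨rfl, rfl⟩ : x = i ∧ y = j := by
      rcases hxy with h' | ⟨rfl, rfl⟩
      · exact h'
      · exact (aux _ rfl).elim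
    obtain ⟨a, b, ha, hb, hab⟩ := cs.exists_reflectionRep_alternatingWord_apply hij
      (k := k + 1) (fun hM ↦ by
        refine lt_of_le_of_ne (cs.le_of_length_mul_wordProd_alternatingWord hl hM) ?_
        intro hk
        apply aux y
        rw [hk, wordProd_alternatingWord_swap])
    rw [map_mul, LinearEquiv.mul_apply, hab, map_add, map_smul, map_smul]
    exact add_nonneg (smul_nonneg ha (ih _ (by omega) hvi rfl))
      (smul_nonneg hb (ih _ (by omega) hvj rfl))

/-- If `i` were a descent, `w * s_i` would send the root to a nonnegative vector, so `w` would send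
it to a nonpositive one; being also nonnegative, it would vanish. -/
theorem not_isRightDescent_of_reflectionRep_nonneg {w : W} {i : B}
    (h : 0 ≤ cs.reflectionRep w (Finsupp.single i 1)) : ¬cs.IsRightDescent w i := by
  intro hd
  have h₁ := cs.reflectionRep_nonneg (cs.isRightDescent_iff_not_isRightDescent_mul.mp hd)
  rw [map_mul, LinearEquiv.mul_apply, reflectionRep_simple_apply_self, map_neg,
    Left.nonneg_neg_iff] at h₁
  have h₂ := le_antisymm h₁ h
  rw [LinearEquiv.map_eq_zero_iff] at h₂
  simp at h₂

theorem length_mul_wordProd_alternatingWord {v : W} {i j : B} (hij : i ≠ j)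
    (hi : ¬cs.IsRightDescent v i) (hj : ¬cs.IsRightDescent v j) {k : ℕ}
    (hk : M i j ≠ 0 → k ≤ M i j) :
    cs.length (v * cs.wordProd (alternatingWord i j k)) = cs.length v + k := by
  induction k generalizing i j with
  | zero => simp [alternatingWord]
  | succ k ih =>
    rw [M.symmetric] at hk
    have hlen := ih hij.symm hj hi (fun h ↦ by have := hk h; omega)
    rw [wordProd_alternatingWord_succ, ← mul_assoc]
    rw [← add_assoc, ← hlen, ← cs.not_isRightDescent_iff]
    apply cs.not_isRightDescent_of_reflectionRep_nonneg
    obtain ⟨a, b, ha, hb, hab⟩ := cs.exists_reflectionRep_alternatingWord_apply hij.symm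
      (k := k) (fun h ↦ by have := hk h; omega)
    rw [map_mul, LinearEquiv.mul_apply, hab, map_add, map_smul, map_smul]
    exact add_nonneg (smul_nonneg ha (cs.reflectionRep_nonneg hj))
      (smul_nonneg hb (cs.reflectionRep_nonneg hi))

theorem isReduced_alternatingWord {i j : B} (hij : i ≠ j) {k : ℕ} (hk : M i j ≠ 0 → k ≤ M i j) :
    cs.IsReduced (alternatingWord i j k) := by
  have := cs.length_mul_wordProd_alternatingWord hij (cs.not_isRightDescent_one i)
    (cs.not_isRightDescent_one j) hk
  simpa [IsReduced] using this

/-- An element with two distinct right descents ends with the corresponding braid word. -/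
theorem IsRightDescent.exists_eq_mul_braidWord {w : W} {i j : B} (hij : i ≠ j)
    (hi : cs.IsRightDescent w i) (hj : cs.IsRightDescent w j) :
    M i j ≠ 0 ∧ ∃ v, w = v * cs.wordProd (braidWord M i j) ∧
      cs.length w = cs.length v + M i j := by
  obtain ⟨v, x, y, k, hxy, rfl, hl, hvi, hvj⟩ := cs.exists_eq_mul_alternatingWord w i j
  have hM : M x y = M i j := by
    rcases hxy with ⟨rfl, rfl⟩ | ⟨rfl, rfl⟩
    · rfl
    · exact M.symmetric _ _
  have hne : x ≠ y := by
    rcases hxy with ⟨rfl, rfl⟩ | ⟨rfl, rfl⟩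
    · exact hij
    · exact hij.symm
  obtain ⟨hx, hvx, hvy⟩ : cs.IsRightDescent (v * cs.wordProd (alternatingWord x y k)) x ∧
      ¬cs.IsRightDescent v x ∧ ¬cs.IsRightDescent v y := by
    rcases hxy with ⟨rfl, rfl⟩ | ⟨rfl, rfl⟩
    · exact ⟨hi, hvi, hvj⟩
    · exact ⟨hj, hvj, hvi⟩
  -- Below the braid length one more letter `x` would still increase the length, contradicting the
  -- descent at `x`.
  have hk : ¬(M x y ≠ 0 → k + 1 ≤ M x y) := by
    intro hk
    have h₁ := cs.length_mul_wordProd_alternatingWord hne.symm hvy hvx (k := k + 1)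
      (by rwa [M.symmetric])
    rw [wordProd_alternatingWord_succ, ← mul_assoc] at h₁
    have h₂ := cs.isRightDescent_iff.mp hx
    omega
  push Not at hk
  have hkM : k = M i j := by
    have := cs.le_of_length_mul_wordProd_alternatingWord hl hk.1
    omega
  refine ⟨hM ▸ hk.1, v, ?_, by omega⟩
  rcases hxy with ⟨rfl, rfl⟩ | ⟨rfl, rfl⟩
  · rw [hkM]
  · rw [hkM, ← wordProd_alternatingWord_swap]

theorem reverse_alternatingWord (i j : B) (k : ℕ) :
    (alternatingWord i j k).reverse =
      if Even k then alternatingWord j i k else alternatingWord i j k := by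
  induction k generalizing i j with
  | zero => simp [alternatingWord]
  | succ k ih =>
    have h : (alternatingWord i j (k + 1)).reverse = j :: (alternatingWord j i k).reverse := by
      simp [alternatingWord_succ]
    rw [h, ih, alternatingWord_succ' i j, alternatingWord_succ' j i]
    rcases Nat.even_or_odd k with hk | hk
    · simp [hk, Nat.even_add_one]
    · simp [Nat.not_even_iff_odd.mpr hk, Nat.even_add_one]

theorem inv_wordProd_braidWord (i j : B) :
    (cs.wordProd (braidWord M i j))⁻¹ = cs.wordProd (braidWord M i j) := by
  rw [← wordProd_reverse, braidWord, reverse_alternatingWord]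
  split_ifs
  · rw [wordProd_alternatingWord_swap]
  · rfl

/-- An element with two distinct left descents begins with the corresponding braid word. -/
theorem IsLeftDescent.exists_eq_braidWord_mul {w : W} {i j : B} (hij : i ≠ j)
    (hi : cs.IsLeftDescent w i) (hj : cs.IsLeftDescent w j) :
    M i j ≠ 0 ∧ ∃ v, w = cs.wordProd (braidWord M i j) * v ∧
      cs.length w = M i j + cs.length v := by
  rw [← cs.isRightDescent_inv_iff] at hi hj
  obtain ⟨hM, v, hv, hl⟩ := IsRightDescent.exists_eq_mul_braidWord cs hij hi hj
  refine ⟨hM, v⁻¹, ?_, by rw [← cs.length_inv w, cs.length_inv v, hl, add_comm]⟩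
  rw [← inv_inv w, hv, mul_inv_rev, inv_wordProd_braidWord]

end CoxeterSystem

/-! ### The canonical lift of a Coxeter group to its Artin–Tits monoid -/

namespace CoxeterMatrix

variable {B : Type*} (M : CoxeterMatrix B)

/-- The element of the Artin–Tits monoid represented by a word. -/
def artinTitsWord (ω : List B) : M.ArtinTitsMonoid :=
  PresentedMonoid.mk M.ArtinTitsRel (FreeMonoid.ofList ω)

/-- The generators of the Artin–Tits monoid. -/
def artinTitsGen (i : B) : M.ArtinTitsMonoid := PresentedMonoid.of M.ArtinTitsRel i

theorem artinTitsWord_nil : M.artinTitsWord [] = 1 := rfl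

theorem artinTitsWord_singleton (i : B) : M.artinTitsWord [i] = M.artinTitsGen i := rfl

theorem artinTitsWord_append (ω ω' : List B) :
    M.artinTitsWord (ω ++ ω') = M.artinTitsWord ω * M.artinTitsWord ω' := rfl

theorem artinTitsWord_cons (i : B) (ω : List B) :
    M.artinTitsWord (i :: ω) = M.artinTitsGen i * M.artinTitsWord ω := rfl

theorem artinTitsWord_surjective : Function.Surjective M.artinTitsWord := fun g ↦ by
  obtain ⟨w, rfl⟩ := PresentedMonoid.surjective_mk g
  exact ⟨FreeMonoid.toList w, rfl⟩

theorem artinTitsWord_braidWord {i j : B} (h : M i j ≠ 0) :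
    M.artinTitsWord (CoxeterSystem.braidWord M i j) =
      M.artinTitsWord (CoxeterSystem.braidWord M j i) := by
  have := PresentedMonoid.mk_eq_mk_of_rel (ArtinTitsRel.braid (m := M) i j h)
  rw [CoxeterSystem.braidWord, CoxeterSystem.braidWord, M.symmetric j i]
  exact this

end CoxeterMatrix

/-! ### Matsumoto's theorem and the lift -/

namespace CoxeterSystem

variable {B : Type*} {W : Type*} [Group W] {M : CoxeterMatrix B} (cs : CoxeterSystem M W)

theorem braidWord_eq_append {i j : B} (h : M i j ≠ 0) :
    braidWord M i j = alternatingWord j i (M i j - 1) ++ [j] := by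
  rw [braidWord, ← List.concat_eq_append, ← alternatingWord_succ, Nat.sub_add_cancel (by omega)]

/-- **Matsumoto's theorem**, in the Artin–Tits monoid: two reduced words for the same element of
the Coxeter group represent the same element of the Artin–Tits monoid. -/
theorem IsReduced.artinTitsWord_eq {ω ω' : List B} (h : cs.IsReduced ω) (h' : cs.IsReduced ω')
    (heq : cs.wordProd ω = cs.wordProd ω') : M.artinTitsWord ω = M.artinTitsWord ω' := by
  induction hn : ω.length using Nat.strong_induction_on generalizing ω ω' with
  | _ n ih =>
    subst hn
    have hlen : ω.length = ω'.length := by rw [← h.eq, ← h'.eq, heq]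
    rcases List.eq_nil_or_concat' ω with rfl | ⟨ω₁, i, rfl⟩
    · rw [List.length_nil, eq_comm, List.length_eq_zero_iff] at hlen
      rw [hlen]
    rcases List.eq_nil_or_concat' ω' with rfl | ⟨ω₂, j, rfl⟩
    · simp at hlen
    have hred (ω : List B) (k : B) (hω : cs.IsReduced (ω ++ [k])) : cs.IsReduced ω := by
      simpa using hω.take ω.length
    have hdes (ω : List B) (k : B) (hω : cs.IsReduced (ω ++ [k])) :
        cs.IsRightDescent (cs.wordProd (ω ++ [k])) k := by
      rw [isRightDescent_iff, hω.eq, wordProd_append, wordProd_singleton,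
        simple_mul_simple_cancel_right, (hred ω k hω).eq]
      simp
    have cancel (ω ω' : List B) (k : B) (hl : ω.length < (ω₁ ++ [i]).length)
        (hω : cs.IsReduced (ω ++ [k])) (hω' : cs.IsReduced (ω' ++ [k]))
        (he : cs.wordProd (ω ++ [k]) = cs.wordProd (ω' ++ [k])) :
        M.artinTitsWord (ω ++ [k]) = M.artinTitsWord (ω' ++ [k]) := by
      rw [M.artinTitsWord_append, M.artinTitsWord_append,
        ih _ hl (hred _ _ hω) (hred _ _ hω') (by simpa [wordProd_append] using he) rfl]
    rcases eq_or_ne i j with rfl | hij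
    · exact cancel _ _ _ (by simp) h h' heq
    -- With different last letters, each word is compared to `η` followed by the braid word with the
    -- same last letter; the two comparison words differ by one braid relation.
    · obtain ⟨hM, v, hv, hl⟩ := IsRightDescent.exists_eq_mul_braidWord cs hij (hdes _ _ h)
        (heq ▸ hdes _ _ h')
      obtain ⟨η, hη, rfl⟩ := cs.exists_isReduced v
      have hM' : M j i ≠ 0 := by rwa [M.symmetric]
      have e₁ : cs.wordProd (η ++ braidWord M i j) = cs.wordProd (ω₁ ++ [i]) := by
        rw [hv, wordProd_append]
      have e₂ : cs.wordProd (η ++ braidWord M j i) = cs.wordProd (ω₁ ++ [i]) := by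
        rw [hv, wordProd_append, wordProd_braidWord_eq]
      have r₁ : cs.IsReduced (η ++ braidWord M i j) := by
        rw [IsReduced, e₁, hl, hη.eq]
        simp
      have r₂ : cs.IsReduced (η ++ braidWord M j i) := by
        rw [IsReduced, e₂, hl, hη.eq, M.symmetric]
        simp
      have h₁ := cancel ω₁ (η ++ alternatingWord i j (M j i - 1)) i (by simp) h
        (by rwa [List.append_assoc, ← braidWord_eq_append hM'])
        (by rw [List.append_assoc, ← braidWord_eq_append hM', e₂])
      have h₂ := cancel ω₂ (η ++ alternatingWord j i (M i j - 1)) j (by simp at hlen ⊢; omega) h'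
        (by rwa [List.append_assoc, ← braidWord_eq_append hM])
        (by rw [List.append_assoc, ← braidWord_eq_append hM, e₁, heq])
      rw [List.append_assoc, ← braidWord_eq_append hM'] at h₁
      rw [List.append_assoc, ← braidWord_eq_append hM] at h₂
      rw [h₁, h₂, M.artinTitsWord_append, M.artinTitsWord_append, M.artinTitsWord_braidWord hM]

/-- The canonical lift of a Coxeter group to the Artin–Tits monoid. -/
noncomputable def artinTitsLift (w : W) : M.ArtinTitsMonoid :=
  M.artinTitsWord (cs.exists_isReduced w).choose

theorem IsReduced.artinTitsLift_wordProd {ω : List B} (h : cs.IsReduced ω) :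
    cs.artinTitsLift (cs.wordProd ω) = M.artinTitsWord ω :=
  IsReduced.artinTitsWord_eq cs (cs.exists_isReduced _).choose_spec.1 h
    (cs.exists_isReduced _).choose_spec.2.symm

theorem artinTitsLift_one : cs.artinTitsLift 1 = 1 := by
  have h : cs.IsReduced [] := by simp [IsReduced]
  simpa [M.artinTitsWord_nil] using h.artinTitsLift_wordProd cs

theorem artinTitsLift_simple (i : B) : cs.artinTitsLift (cs.simple i) = M.artinTitsGen i := by
  have h : cs.IsReduced [i] := by simp [IsReduced]
  simpa [M.artinTitsWord_singleton] using h.artinTitsLift_wordProd cs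

/-! ### Reduced products and the prefix order -/

/-- The product `u * v` is reduced: lengths add up. -/
def IsReducedMul (u v : W) : Prop := cs.length (u * v) = cs.length u + cs.length v

variable {cs}

theorem IsReducedMul.artinTitsLift_mul {u v : W} (h : cs.IsReducedMul u v) :
    cs.artinTitsLift (u * v) = cs.artinTitsLift u * cs.artinTitsLift v := by
  obtain ⟨ω, hω, rfl⟩ := cs.exists_isReduced u
  obtain ⟨ω', hω', rfl⟩ := cs.exists_isReduced v
  have hr : cs.IsReduced (ω ++ ω') := by
    rw [IsReduced, wordProd_append, h, hω.eq, hω'.eq, List.length_append]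
  rw [hω.artinTitsLift_wordProd, hω'.artinTitsLift_wordProd, ← wordProd_append,
    hr.artinTitsLift_wordProd, M.artinTitsWord_append]

theorem IsReducedMul.one_right (u : W) : cs.IsReducedMul u 1 := by simp [IsReducedMul]

theorem IsReducedMul.one_left (u : W) : cs.IsReducedMul 1 u := by simp [IsReducedMul]

/-- Both sides say that the length of `u * v * w` is the sum of the three lengths. -/
theorem isReducedMul_assoc {u v w : W} :
    cs.IsReducedMul u v ∧ cs.IsReducedMul (u * v) w ↔
      cs.IsReducedMul v w ∧ cs.IsReducedMul u (v * w) := by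
  have h₁ := cs.length_mul_le u v
  have h₂ := cs.length_mul_le (u * v) w
  have h₃ := cs.length_mul_le v w
  have h₄ := cs.length_mul_le u (v * w)
  rw [← mul_assoc] at h₄
  simp only [IsReducedMul, ← mul_assoc]
  omega

variable (cs) in
/-- The prefix order (right weak order) of a Coxeter group. -/
def IsPrefix (u v : W) : Prop := ∃ x, v = u * x ∧ cs.IsReducedMul u x

theorem IsPrefix.refl (u : W) : cs.IsPrefix u u := ⟨1, by simp, .one_right u⟩

theorem IsPrefix.one_left (u : W) : cs.IsPrefix 1 u := ⟨u, by simp, .one_left u⟩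

theorem IsPrefix.trans {u v w : W} (h : cs.IsPrefix u v) (h' : cs.IsPrefix v w) :
    cs.IsPrefix u w := by
  obtain ⟨x, rfl, hx⟩ := h
  obtain ⟨y, rfl, hy⟩ := h'
  exact ⟨x * y, mul_assoc _ _ _, (isReducedMul_assoc.mp ⟨hx, hy⟩).2⟩

theorem IsPrefix.antisymm {u v : W} (h : cs.IsPrefix u v) (h' : cs.IsPrefix v u) : u = v := by
  obtain ⟨x, rfl, hx⟩ := h
  obtain ⟨y, hy, hy'⟩ := h'
  have h₁ : cs.length u = cs.length (u * x) + cs.length y := by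
    conv_lhs => rw [hy]
    exact hy'
  rw [IsReducedMul] at hx
  have h₂ : x = 1 := cs.length_eq_zero_iff.mp (by omega)
  simp [h₂]

theorem IsPrefix.mul_left {u v w : W} (h : cs.IsPrefix v w) (hw : cs.IsReducedMul u w) :
    cs.IsPrefix (u * v) (u * w) := by
  obtain ⟨x, rfl, hx⟩ := h
  exact ⟨x, by rw [mul_assoc], (isReducedMul_assoc.mpr ⟨hx, hw⟩).2⟩

theorem IsPrefix.of_mul_left {u v w : W} (h : cs.IsPrefix (u * v) (u * w))
    (hv : cs.IsReducedMul u v) : cs.IsPrefix v w := by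
  obtain ⟨x, hx, hx'⟩ := h
  rw [mul_assoc, mul_right_inj] at hx
  exact ⟨x, hx, (isReducedMul_assoc.mp ⟨hv, hx'⟩).1⟩

theorem IsReducedMul.of_isPrefix {u v w : W} (h : cs.IsPrefix v w) (hw : cs.IsReducedMul u w) :
    cs.IsReducedMul u v := by
  obtain ⟨x, rfl, hx⟩ := h
  exact (isReducedMul_assoc.mpr ⟨hx, hw⟩).1

theorem isPrefix_simple_iff {i : B} {w : W} :
    cs.IsPrefix (cs.simple i) w ↔ cs.IsLeftDescent w i := by
  rw [isLeftDescent_iff]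
  constructor
  · rintro ⟨x, rfl, hx⟩
    rw [hx, simple_mul_simple_cancel_left, length_simple, add_comm]
  · intro h
    refine ⟨cs.simple i * w, by simp, ?_⟩
    rw [IsReducedMul, simple_mul_simple_cancel_left, length_simple, ← h, add_comm]

theorem isReducedMul_simple_iff {i : B} {w : W} :
    cs.IsReducedMul w (cs.simple i) ↔ ¬cs.IsRightDescent w i := by
  rw [not_isRightDescent_iff, IsReducedMul, length_simple]

theorem isReducedMul_braidWord {u : W} {i j : B} (hij : i ≠ j)
    (hi : cs.IsReducedMul u (cs.simple i)) (hj : cs.IsReducedMul u (cs.simple j)) :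
    cs.IsReducedMul u (cs.wordProd (braidWord M i j)) := by
  rw [isReducedMul_simple_iff] at hi hj
  rw [IsReducedMul, cs.length_mul_wordProd_alternatingWord hij hi hj (fun _ ↦ le_rfl),
    (cs.isReduced_alternatingWord hij (fun _ ↦ le_rfl)).eq, length_alternatingWord]

theorem braidWord_isPrefix {w : W} {i j : B} (hij : i ≠ j) (hi : cs.IsPrefix (cs.simple i) w)
    (hj : cs.IsPrefix (cs.simple j) w) :
    M i j ≠ 0 ∧ cs.IsPrefix (cs.wordProd (braidWord M i j)) w := by
  rw [isPrefix_simple_iff] at hi hj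
  obtain ⟨hM, v, hv, hl⟩ := IsLeftDescent.exists_eq_braidWord_mul cs hij hi hj
  refine ⟨hM, v, hv, ?_⟩
  rw [IsReducedMul, ← hv, hl, (cs.isReduced_alternatingWord hij (fun _ ↦ le_rfl)).eq,
    length_alternatingWord]

theorem simple_isPrefix_braidWord {i j : B} (hij : i ≠ j) (hM : M i j ≠ 0) :
    cs.IsPrefix (cs.simple j) (cs.wordProd (braidWord M i j)) := by
  have h₁ : cs.IsRightDescent (cs.wordProd (braidWord M i j)) j := by
    have h₂ := cs.isReduced_alternatingWord hij (fun _ ↦ le_refl (M i j))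
    rw [isRightDescent_iff, h₂.eq, braidWord_eq_append hM, wordProd_append, wordProd_singleton,
      simple_mul_simple_cancel_right,
      (cs.isReduced_alternatingWord hij.symm (fun _ ↦ by rw [M.symmetric]; omega)).eq,
      length_alternatingWord, length_alternatingWord]
    omega
  rwa [isPrefix_simple_iff, ← isRightDescent_inv_iff, inv_wordProd_braidWord]

theorem exists_simple_isPrefix {w : W} (hw : w ≠ 1) : ∃ i, cs.IsPrefix (cs.simple i) w := by
  obtain ⟨i, hi⟩ := cs.exists_leftDescent_of_ne_one hw
  exact ⟨i, isPrefix_simple_iff.mpr hi⟩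

/-- Among the prefixes `x` of `v` such that the product `u * x` is reduced, there is a greatest
one. -/
theorem exists_greatest_isPrefix (cs : CoxeterSystem M W) (u v : W) :
    ∃ x, cs.IsPrefix x v ∧ cs.IsReducedMul u x ∧
      ∀ y, cs.IsPrefix y v → cs.IsReducedMul u y → cs.IsPrefix y x := by
  induction hn : cs.length v using Nat.strong_induction_on generalizing u v with
  | _ n ih =>
    subst hn
    by_cases h : ∃ i, cs.IsPrefix (cs.simple i) v ∧ cs.IsReducedMul u (cs.simple i)
    · obtain ⟨i, hiv, hi⟩ := h
      -- By induction, the admissible prefixes beginning with a given letter `j` have a greatest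
      -- one.
      have step (j : B) (hjv : cs.IsPrefix (cs.simple j) v) (hj : cs.IsReducedMul u (cs.simple j)) :
          ∃ x, cs.IsPrefix (cs.simple j * x) v ∧ cs.IsReducedMul (cs.simple j) x ∧
            cs.IsReducedMul u (cs.simple j * x) ∧
            ∀ y, cs.IsPrefix (cs.simple j * y) v → cs.IsReducedMul (cs.simple j) y →
              cs.IsReducedMul u (cs.simple j * y) → cs.IsPrefix y x := by
        obtain ⟨v', rfl, hv'⟩ := hjv
        obtain ⟨x, hx, hux, hmax⟩ := ih (cs.length v') (by rw [hv', length_simple]; omega)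
          (u * cs.simple j) v' rfl
        have h₁ := isReducedMul_assoc.mp ⟨hj, hux⟩
        refine ⟨x, hx.mul_left hv', h₁.1, h₁.2, fun y hy hjy huy ↦ hmax y ?_ ?_⟩
        · exact hy.of_mul_left hjy
        · exact (isReducedMul_assoc.mpr ⟨hjy, huy⟩).2
      obtain ⟨x, hxv, hix, hux, hmax⟩ := step i hiv hi
      refine ⟨_, hxv, hux, fun y hyv huy ↦ ?_⟩
      rcases eq_or_ne y 1 with rfl | hy
      · exact .one_left _
      obtain ⟨j, hjy⟩ := cs.exists_simple_isPrefix hy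
      have hjv := hjy.trans hyv
      have huj := huy.of_isPrefix hjy
      obtain ⟨y', rfl, hjy'⟩ := hjy
      rcases eq_or_ne i j with rfl | hij
      · exact (hmax y' hyv hjy' huy).mul_left hix
      -- The braid word of `i` and `j` is itself admissible, hence a prefix of `s_j * z`. So `s_j *
      -- z` also begins with `i` and lies below `s_i * x`.
      · obtain ⟨z, hzv, hjz, huz, hmax'⟩ := step j hjv huj
        have h₁ : cs.IsPrefix (cs.simple j * y') (cs.simple j * z) :=
          (hmax' y' hyv hjy' huy).mul_left hjz
        refine h₁.trans ?_
        obtain ⟨hM, hbv⟩ := braidWord_isPrefix hij hiv hjv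
        have hub := isReducedMul_braidWord hij hi huj
        have hjb := simple_isPrefix_braidWord (cs := cs) hij hM
        have hib := simple_isPrefix_braidWord (cs := cs) hij.symm (by rwa [M.symmetric])
        rw [wordProd_braidWord_eq] at hib
        have h₂ : cs.IsPrefix (cs.wordProd (braidWord M i j)) (cs.simple j * z) := by
          obtain ⟨b, hb, hjb⟩ := hjb
          rw [hb] at hbv hub ⊢
          exact (hmax' b hbv hjb hub).mul_left hjz
        obtain ⟨c, hc, hic⟩ := hib.trans h₂
        rw [hc] at hzv huz ⊢
        exact (hmax c hzv hic huz).mul_left hix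
    · push Not at h
      refine ⟨1, .one_left _, .one_right _, fun y hy huy ↦ ?_⟩
      rcases eq_or_ne y 1 with rfl | hy1
      · exact .refl _
      obtain ⟨j, hjy⟩ := cs.exists_simple_isPrefix hy1
      exact (h j (hjy.trans hy) (huy.of_isPrefix hjy)).elim

variable (cs) in
/-- The greatest prefix `x` of `v` such that the product `u * x` is reduced. -/
noncomputable def greatestPrefix (u v : W) : W := (cs.exists_greatest_isPrefix u v).choose

theorem greatestPrefix_isPrefix (u v : W) : cs.IsPrefix (cs.greatestPrefix u v) v :=
  (cs.exists_greatest_isPrefix u v).choose_spec.1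

theorem isReducedMul_greatestPrefix (u v : W) : cs.IsReducedMul u (cs.greatestPrefix u v) :=
  (cs.exists_greatest_isPrefix u v).choose_spec.2.1

theorem isPrefix_greatestPrefix {u v y : W} (h : cs.IsPrefix y v) (h' : cs.IsReducedMul u y) :
    cs.IsPrefix y (cs.greatestPrefix u v) :=
  (cs.exists_greatest_isPrefix u v).choose_spec.2.2 y h h'

theorem greatestPrefix_one_left (v : W) : cs.greatestPrefix 1 v = v :=
  (greatestPrefix_isPrefix 1 v).antisymm (isPrefix_greatestPrefix (.refl v) (.one_left v))

theorem IsPrefix.isReducedMul_inv_mul {u v : W} (h : cs.IsPrefix u v) :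
    cs.IsReducedMul u (u⁻¹ * v) := by
  obtain ⟨x, rfl, hx⟩ := h
  simpa using hx

/-- Absorption in two stages, by `v` and then by `u`, keeps exactly what `u * v` absorbs at once;
this makes `headAct` multiplicative on reduced products. -/
theorem IsReducedMul.greatestPrefix_mul {u v : W} (h : cs.IsReducedMul u v) (w : W) :
    cs.greatestPrefix u (v * cs.greatestPrefix v w) = v * cs.greatestPrefix (u * v) w := by
  have h₁ := isReducedMul_assoc.mp ⟨h, isReducedMul_greatestPrefix (cs := cs) (u * v) w⟩
  have h₂ := isReducedMul_greatestPrefix (cs := cs) v w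
  apply IsPrefix.antisymm
  · obtain ⟨x, hx, hvx⟩ := isPrefix_greatestPrefix (cs := cs) (u := u)
      (⟨_, rfl, h₂⟩ : cs.IsPrefix v (v * cs.greatestPrefix v w)) h
    have h₃ := greatestPrefix_isPrefix (cs := cs) u (v * cs.greatestPrefix v w)
    have h₄ := isReducedMul_greatestPrefix (cs := cs) u (v * cs.greatestPrefix v w)
    rw [hx] at h₃ h₄ ⊢
    refine IsPrefix.mul_left ?_ h₁.1
    exact isPrefix_greatestPrefix ((h₃.of_mul_left hvx).trans (greatestPrefix_isPrefix v w))
      (isReducedMul_assoc.mpr ⟨hvx, h₄⟩).2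
  · apply isPrefix_greatestPrefix _ h₁.2
    exact (isPrefix_greatestPrefix (greatestPrefix_isPrefix _ _) h₁.1).mul_left h₂

/-! ### The action on head-tail pairs -/

variable (cs) in
/-- The action of a lifted element `u` on pairs `(w, g)`, thought of as factored elements `w * g` of
the Artin–Tits monoid: as much as possible of `w` is absorbed by `u`, and the rest goes to `g`. -/
noncomputable def headAct (u : W) : Function.End (W × M.ArtinTitsMonoid) := fun p ↦
  (u * cs.greatestPrefix u p.1, cs.artinTitsLift ((cs.greatestPrefix u p.1)⁻¹ * p.1) * p.2)

theorem headAct_one : cs.headAct 1 = 1 := by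
  funext p
  simp [headAct, greatestPrefix_one_left, artinTitsLift_one, Function.End.one_def]

theorem IsReducedMul.headAct_mul {u v : W} (h : cs.IsReducedMul u v) :
    cs.headAct u * cs.headAct v = cs.headAct (u * v) := by
  funext ⟨w, g⟩
  have h₁ := (isReducedMul_assoc.mp ⟨h, isReducedMul_greatestPrefix (cs := cs) (u * v) w⟩).1
  obtain ⟨y, hy, hxy⟩ :=
    isPrefix_greatestPrefix (greatestPrefix_isPrefix (cs := cs) (u * v) w) h₁
  obtain ⟨z, hz, hyz⟩ := greatestPrefix_isPrefix (cs := cs) v w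
  change cs.headAct u (cs.headAct v (w, g)) = cs.headAct (u * v) (w, g)
  simp only [headAct, h.greatestPrefix_mul, mul_assoc]
  refine Prod.ext rfl ?_
  set x := cs.greatestPrefix (u * v) w
  simp only [← mul_assoc]
  -- `z` is the part of `w` rejected by `v`, and `y` the part then rejected by `u`. Their product is
  -- reduced, so its lift splits.
  congr 1
  have e₁ : (v * x)⁻¹ * v * cs.greatestPrefix v w = y := by rw [hy]; group
  have e₂ : (cs.greatestPrefix v w)⁻¹ * w = z := inv_mul_eq_of_eq_mul hz
  have e₃ : x⁻¹ * w = y * z := by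
    rw [inv_mul_eq_iff_eq_mul, ← mul_assoc, ← hy]
    exact hz
  rw [e₁, e₂, e₃, IsReducedMul.artinTitsLift_mul]
  rw [hy] at hyz
  exact (isReducedMul_assoc.mp ⟨hxy, hyz⟩).1

theorem IsReduced.prod_map_headAct {ω : List B} (h : cs.IsReduced ω) :
    (ω.map fun i ↦ cs.headAct (cs.simple i)).prod = cs.headAct (cs.wordProd ω) := by
  induction ω with
  | nil => simp [headAct_one]
  | cons i ω ih =>
    have h' : cs.IsReduced ω := by simpa using h.drop 1
    rw [List.map_cons, List.prod_cons, ih h', wordProd_cons, IsReducedMul.headAct_mul]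
    rw [IsReducedMul, ← wordProd_cons, h.eq, h'.eq, length_simple, List.length_cons, add_comm]

variable (cs) in
/-- The action of the Artin–Tits monoid on pairs that extends `headAct`. -/
noncomputable def headHom : M.ArtinTitsMonoid →* Function.End (W × M.ArtinTitsMonoid) :=
  PresentedMonoid.lift (fun i ↦ cs.headAct (cs.simple i)) <| by
    rintro _ _ ⟨i, j, hM⟩
    rcases eq_or_ne i j with rfl | hij
    · rfl
    -- Both sides of the braid relation are reduced words of one group element, and a reduced word
    -- acts through its product alone.
    · simp only [FreeMonoid.lift_ofList]
      rw [(cs.isReduced_alternatingWord hij fun _ ↦ le_rfl).prod_map_headAct,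
        (cs.isReduced_alternatingWord hij.symm fun _ ↦ (M.symmetric i j).le).prod_map_headAct,
        wordProd_alternatingWord_swap]

theorem headHom_gen (i : B) : cs.headHom (M.artinTitsGen i) = cs.headAct (cs.simple i) :=
  PresentedMonoid.lift_of _ _

variable (cs) in
/-- The decomposition of an element of the Artin–Tits monoid into its greatest left-divisor that
is lifted from the Coxeter group and the complement. -/
noncomputable def headTail (g : M.ArtinTitsMonoid) : W × M.ArtinTitsMonoid := cs.headHom g (1, 1)

theorem headTail_gen_mul (i : B) (g : M.ArtinTitsMonoid) :
    cs.headTail (M.artinTitsGen i * g) = cs.headAct (cs.simple i) (cs.headTail g) := by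
  rw [headTail, map_mul, headHom_gen]
  rfl

theorem artinTitsLift_headAct (u : W) (p : W × M.ArtinTitsMonoid) :
    cs.artinTitsLift (cs.headAct u p).1 * (cs.headAct u p).2 =
      cs.artinTitsLift u * (cs.artinTitsLift p.1 * p.2) := by
  obtain ⟨w, g⟩ := p
  simp only [headAct]
  rw [(isReducedMul_greatestPrefix u w).artinTitsLift_mul, mul_assoc, ← mul_assoc _ _ g,
    ← (greatestPrefix_isPrefix u w).isReducedMul_inv_mul.artinTitsLift_mul, mul_inv_cancel_left]

variable (cs) in
theorem artinTitsLift_headTail (g : M.ArtinTitsMonoid) :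
    cs.artinTitsLift (cs.headTail g).1 * (cs.headTail g).2 = g := by
  obtain ⟨ω, rfl⟩ := M.artinTitsWord_surjective g
  induction ω with
  | nil => simp [M.artinTitsWord_nil, headTail, Function.End.one_def, artinTitsLift_one]
  | cons i ω ih =>
    rw [M.artinTitsWord_cons, headTail_gen_mul, artinTitsLift_headAct, ih, artinTitsLift_simple]

end CoxeterSystem

/-! ### Cancellation and lcms of generators -/

namespace CoxeterMatrix

open CoxeterSystem

variable {B : Type*} (M : CoxeterMatrix B)

/-- The pair obtained by acting with `s_i` determines both the absorbed prefix and the new tail, and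
`g` is the lifted prefix times that tail. -/
theorem artinTitsGen_mul_left_cancel (i : B) {g h : M.ArtinTitsMonoid}
    (e : M.artinTitsGen i * g = M.artinTitsGen i * h) : g = h := by
  let cs := M.toCoxeterSystem
  have h₁ : cs.headAct (cs.simple i) (cs.headTail g) = cs.headAct (cs.simple i) (cs.headTail h) := by
    rw [← headTail_gen_mul, ← headTail_gen_mul, e]
  simp only [headAct, Prod.mk.injEq, mul_right_inj] at h₁
  have key (k : M.ArtinTitsMonoid) : k =
      cs.artinTitsLift (cs.greatestPrefix (cs.simple i) (cs.headTail k).1) *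
        (cs.artinTitsLift ((cs.greatestPrefix (cs.simple i) (cs.headTail k).1)⁻¹ *
          (cs.headTail k).1) * (cs.headTail k).2) := by
    rw [← mul_assoc,
      ← (greatestPrefix_isPrefix (cs := cs) _ _).isReducedMul_inv_mul.artinTitsLift_mul,
      mul_inv_cancel_left, artinTitsLift_headTail]
  rw [key g, key h, h₁.2, h₁.1]

instance : IsLeftCancelMul M.ArtinTitsMonoid where
  mul_left_cancel a b c h := by
    obtain ⟨ω, rfl⟩ := M.artinTitsWord_surjective a
    induction ω with
    | nil => simpa [M.artinTitsWord_nil] using h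
    | cons i ω ih =>
      simp only [M.artinTitsWord_cons, mul_assoc] at h
      exact ih (M.artinTitsGen_mul_left_cancel i h)

theorem artinTitsGen_dvd_braidWord {i j : B} (h : M i j ≠ 0) :
    M.artinTitsGen i ∣ M.artinTitsWord (braidWord M i j) := by
  have key (k l : B) (n : ℕ) : M.artinTitsGen l ∣ M.artinTitsWord (alternatingWord l k (n + 1)) ∨
      M.artinTitsGen l ∣ M.artinTitsWord (alternatingWord k l (n + 1)) := by
    rw [alternatingWord_succ', alternatingWord_succ', M.artinTitsWord_cons, M.artinTitsWord_cons]
    split_ifs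
    · exact .inr (dvd_mul_right _ _)
    · exact .inl (dvd_mul_right _ _)
  obtain ⟨n, hn⟩ := Nat.exists_eq_succ_of_ne_zero h
  rcases key j i n with h' | h'
  · rwa [braidWord, hn]
  · rwa [M.artinTitsWord_braidWord h, braidWord, M.symmetric j i, hn]

/-- A common right-multiple of two distinct generators is a right-multiple of the corresponding
braid word. -/
theorem artinTitsWord_braidWord_dvd {i j : B} (hij : i ≠ j) {g : M.ArtinTitsMonoid}
    (hi : M.artinTitsGen i ∣ g) (hj : M.artinTitsGen j ∣ g) :
    M i j ≠ 0 ∧ M.artinTitsWord (braidWord M i j) ∣ g := by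
  let cs := M.toCoxeterSystem
  -- Generators dividing `g` are prefixes of its head, which moves the question into the Coxeter
  -- group.
  have key (k : B) (hk : M.artinTitsGen k ∣ g) : cs.IsPrefix (cs.simple k) (cs.headTail g).1 := by
    obtain ⟨g', rfl⟩ := hk
    rw [headTail_gen_mul]
    exact ⟨_, rfl, isReducedMul_greatestPrefix _ _⟩
  obtain ⟨hM, z, hz, hbz⟩ := braidWord_isPrefix hij (key i hi) (key j hj)
  refine ⟨hM, ?_⟩
  rw [← cs.artinTitsLift_headTail g, hz, hbz.artinTitsLift_mul, mul_assoc,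
    (cs.isReduced_alternatingWord hij fun _ ↦ le_rfl).artinTitsLift_wordProd]
  exact dvd_mul_right _ _

/-- The length homomorphism of the Artin–Tits monoid. -/
def artinTitsLength : M.ArtinTitsMonoid →* Multiplicative ℕ :=
  PresentedMonoid.lift (fun _ ↦ Multiplicative.ofAdd 1) <| by
    rintro _ _ ⟨i, j, hM⟩
    simp [FreeMonoid.lift_ofList]

theorem artinTitsLength_gen (i : B) : M.artinTitsLength (M.artinTitsGen i) = .ofAdd 1 := rfl

theorem eq_one_of_artinTitsLength {g : M.ArtinTitsMonoid} (h : M.artinTitsLength g = 1) :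
    g = 1 := by
  obtain ⟨ω, rfl⟩ := M.artinTitsWord_surjective g
  cases ω with
  | nil => rfl
  | cons i ω =>
    rw [M.artinTitsWord_cons, map_mul, artinTitsLength_gen] at h
    have := congrArg Multiplicative.toAdd h
    simp at this

end CoxeterMatrix

/-! ### Garside families -/

namespace Garside

variable {M : Type*} [Monoid M]

theorem IsMonoidAtom.mem_of_prod_eq {a : M} (ha : IsMonoidAtom a) {l : List M} (h : l.prod = a) :
    a ∈ l := by
  induction l with
  | nil => exact (ha.1 (by simpa using h.symm)).elim
  | cons s l ih =>
    rw [List.prod_cons] at h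
    rcases ha.2 s ⟨_, h.symm⟩ with rfl | rfl
    · exact List.mem_cons_of_mem _ (ih (by simpa using h))
    · exact List.mem_cons_self

theorem IsGarsideFamily.atoms_subset {F : Set M} (hF : IsGarsideFamily F) : atoms M ⊆ F := by
  intro a ha
  obtain ⟨l, hl, hlF, -⟩ := hF.2 a
  exact hlF a (IsMonoidAtom.mem_of_prod_eq ha hl)

/-- Greediness is applied from the far end of the list; the arbitrary left factor `f` takes in the
entries already passed. -/
theorem dvd_mul_of_isChain {F : Set M} {g f s : M} {l : List M}
    (hl : (s :: l).IsChain (IsGreedyPair F)) (hg : g ∈ F) (h : g ∣ f * (s :: l).prod) :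
    g ∣ f * s := by
  induction l generalizing f s with
  | nil => simpa using h
  | cons t l ih =>
    rw [List.isChain_cons_cons] at hl
    refine hl.1 g hg f (ih hl.2 ?_)
    rwa [List.prod_cons, ← mul_assoc] at h

theorem dvd_of_mul_dvd_mul_left [IsLeftCancelMul M] {a b c : M} (h : a * b ∣ a * c) : b ∣ c := by
  obtain ⟨d, hd⟩ := h
  rw [mul_assoc] at hd
  exact ⟨d, mul_left_cancel hd⟩

theorem IsGarsideFamily.closedUnderRightDivisor [IsLeftCancelMul M]
    (hM : ∀ f g : M, f ∣ g → g ∣ f → f = g) {F : Set M} (hF : IsGarsideFamily F) :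
    ClosedUnderRightDivisor F := by
  rintro _ hg f ⟨g', rfl⟩
  obtain ⟨l, rfl, hlF, hl⟩ := hF.2 f
  cases l with
  | nil => exact hF.1
  | cons s l =>
    -- `g' * f` lies in `F`, so it left-divides `g' * s`; cancelling `g'` shows that `f` equals its
    -- first entry `s`.
    have h := dvd_of_mul_dvd_mul_left (dvd_mul_of_isChain hl hg dvd_rfl)
    rw [hM _ _ h (by rw [List.prod_cons]; exact dvd_mul_right _ _)]
    exact hlF s List.mem_cons_self

theorem IsGarsideFamily.closedUnderRightLcm (hM : ∀ f g : M, f ∣ g → g ∣ f → f = g) {F : Set M}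
    (hF : IsGarsideFamily F) : ClosedUnderRightLcm F := by
  rintro f hf g hg h ⟨hfh, hgh, hmin⟩
  obtain ⟨l, rfl, hlF, hl⟩ := hF.2 h
  cases l with
  | nil => exact hF.1
  | cons s l =>
    have key (k : M) (hk : k ∈ F) (hd : k ∣ (s :: l).prod) : k ∣ s := by
      simpa using dvd_mul_of_isChain (f := 1) hl hk (by simpa using hd)
    rw [hM _ _ (hmin s (key f hf hfh) (key g hg hgh))
      (by rw [List.prod_cons]; exact dvd_mul_right _ _)]
    exact hlF s List.mem_cons_self

theorem IsGarsideFamily.rightClosure_subset [IsLeftCancelMul M]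
    (hM : ∀ f g : M, f ∣ g → g ∣ f → f = g) {F : Set M} (hF : IsGarsideFamily F) :
    rightClosure (atoms M) ⊆ F :=
  Set.sInter_subset_of_mem
    ⟨hF.atoms_subset, hF.closedUnderRightLcm hM, hF.closedUnderRightDivisor hM⟩

theorem subset_rightClosure (X : Set M) : X ⊆ rightClosure X :=
  Set.subset_sInter fun _ hF ↦ hF.1

theorem closedUnderRightLcm_rightClosure (X : Set M) : ClosedUnderRightLcm (rightClosure X) :=
  fun f hf g hg h hh F hF ↦ hF.2.1 f (hf F hF) g (hg F hF) h hh

theorem closedUnderRightDivisor_rightClosure (X : Set M) :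
    ClosedUnderRightDivisor (rightClosure X) :=
  fun g hg f hf F hF ↦ hF.2.2 g (hg F hF) f hf

/-- Needed because the closure of an empty set of atoms is empty and so misses `1`. -/
theorem ClosedUnderRightLcm.insert_one (hM : ∀ f g : M, f ∣ g → g ∣ f → f = g) {F : Set M}
    (hF : ClosedUnderRightLcm F) : ClosedUnderRightLcm (insert 1 F) := by
  rintro f (rfl | hf) g hg h ⟨hfh, hgh, hmin⟩
  · rwa [hM _ _ (hmin g (one_dvd g) dvd_rfl) hgh]
  · rcases hg with rfl | hg
    · rw [hM _ _ (hmin f dvd_rfl (one_dvd f)) hfh]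
      exact .inr hf
    · exact .inr (hF f hf g hg h ⟨hfh, hgh, hmin⟩)

theorem ClosedUnderRightDivisor.insert_one (hM : ∀ f g : M, f ∣ g → g ∣ f → f = g) {F : Set M}
    (hF : ClosedUnderRightDivisor F) : ClosedUnderRightDivisor (insert 1 F) := by
  rintro g (rfl | hg) f hf
  · obtain ⟨g', hg'⟩ := hf
    have h := hM g' 1 ⟨f, hg'⟩ (one_dvd g')
    rw [h, one_mul] at hg'
    exact .inl hg'.symm
  · exact .inr (hF g hg f hf)

/-- A finite set that contains `1` and is closed under right-lcm contains, for every `g`, a greatest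
left-divisor of `g` in the set, provided that right-lcms exist whenever possible. -/
theorem ClosedUnderRightLcm.exists_greatest_dvd
    (hlcm : ∀ f g k : M, f ∣ k → g ∣ k → ∃ h, IsRightLcm f g h) {F : Set M} (hfin : F.Finite)
    (h1 : 1 ∈ F) (hF : ClosedUnderRightLcm F) (g : M) :
    ∃ a ∈ F, a ∣ g ∧ ∀ s ∈ F, s ∣ g → s ∣ a := by
  have key (T : Set M) (hT : T.Finite) : T ⊆ F → ∃ a ∈ F, a ∣ g ∧ ∀ s ∈ T, s ∣ g → s ∣ a := by
    induction T, hT using Set.Finite.induction_on with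
    | empty => exact fun _ ↦ ⟨1, h1, one_dvd g, by simp⟩
    | @insert s T _ _ ih =>
      intro hTF
      obtain ⟨a, haF, hag, ha⟩ := ih ((Set.subset_insert _ _).trans hTF)
      by_cases hsg : s ∣ g
      · obtain ⟨h, hh⟩ := hlcm a s g hag hsg
        refine ⟨h, hF a haF s (hTF (Set.mem_insert _ _)) h hh, hh.2.2 g hag hsg, ?_⟩
        rintro t (rfl | ht) htg
        · exact hh.2.1
        · exact (ha t ht htg).trans hh.1
      · refine ⟨a, haF, hag, ?_⟩
        rintro t (rfl | ht) htg
        · exact (hsg htg).elim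
        · exact ha t ht htg
  exact key F hfin subset_rfl

end Garside

/-! ### Right-lcms and normal decompositions in Artin–Tits monoids -/

namespace CoxeterMatrix

open CoxeterSystem Garside

variable {B : Type*} (M : CoxeterMatrix B)

theorem eq_of_dvd_of_dvd {f g : M.ArtinTitsMonoid} (h : f ∣ g) (h' : g ∣ f) : f = g := by
  obtain ⟨c, rfl⟩ := h
  obtain ⟨d, hd⟩ := h'
  have hcd : c * d = 1 := by
    apply mul_left_cancel (a := f)
    rw [← mul_assoc, ← hd, mul_one]
  have hl : M.artinTitsLength c * M.artinTitsLength d = 1 := by rw [← map_mul, hcd, map_one]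
  have hl' := congrArg Multiplicative.toAdd hl
  rw [toAdd_mul, toAdd_one] at hl'
  have hc : M.artinTitsLength c = 1 := by
    apply Multiplicative.toAdd.injective
    rw [toAdd_one]
    omega
  rw [M.eq_one_of_artinTitsLength hc, mul_one]

theorem artinTits_eq_one_or (g : M.ArtinTitsMonoid) :
    g = 1 ∨ ∃ i g', g = M.artinTitsGen i * g' := by
  obtain ⟨ω, rfl⟩ := M.artinTitsWord_surjective g
  cases ω with
  | nil => exact .inl rfl
  | cons i ω => exact .inr ⟨i, _, M.artinTitsWord_cons i ω⟩

theorem toAdd_artinTitsLength_mul (f g : M.ArtinTitsMonoid) :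
    (M.artinTitsLength (f * g)).toAdd = (M.artinTitsLength f).toAdd + (M.artinTitsLength g).toAdd :=
  by rw [map_mul, toAdd_mul]

theorem artinTitsGen_mem_atoms (i : B) : M.artinTitsGen i ∈ atoms M.ArtinTitsMonoid := by
  refine ⟨fun h ↦ ?_, ?_⟩
  · have := congrArg (fun g ↦ (M.artinTitsLength g).toAdd) h
    simp [artinTitsLength_gen] at this
  · rintro f ⟨c, hc⟩
    rcases M.artinTits_eq_one_or f with rfl | ⟨j, f', rfl⟩
    · exact .inl rfl
    · right
      have hl := M.toAdd_artinTitsLength_mul (M.artinTitsGen j * f') c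
      rw [← hc, toAdd_artinTitsLength_mul, artinTitsLength_gen, artinTitsLength_gen,
        toAdd_ofAdd] at hl
      have hc1 : c = 1 := by
        apply M.eq_one_of_artinTitsLength
        apply Multiplicative.toAdd.injective
        rw [toAdd_one]
        omega
      rw [hc, hc1, mul_one]

theorem exists_isRightLcm_gen {i j : B} {g : M.ArtinTitsMonoid} (hi : M.artinTitsGen i ∣ g)
    (hj : M.artinTitsGen j ∣ g) : ∃ h, IsRightLcm (M.artinTitsGen i) (M.artinTitsGen j) h := by
  rcases eq_or_ne i j with rfl | hij
  · exact ⟨_, dvd_rfl, dvd_rfl, fun _ h _ ↦ h⟩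
  · obtain ⟨hM, -⟩ := M.artinTitsWord_braidWord_dvd hij hi hj
    refine ⟨_, M.artinTitsGen_dvd_braidWord hM, ?_,
      fun k hk hk' ↦ (M.artinTitsWord_braidWord_dvd hij hk hk').2⟩
    rw [M.artinTitsWord_braidWord hM]
    exact M.artinTitsGen_dvd_braidWord (by rwa [M.symmetric])

/-- In an Artin–Tits monoid, two elements with a common right-multiple have a right-lcm. -/
theorem exists_isRightLcm {x y k : M.ArtinTitsMonoid} (hx : x ∣ k) (hy : y ∣ k) :
    ∃ h, IsRightLcm x y h := by
  induction hn : (M.artinTitsLength k).toAdd using Nat.strong_induction_on generalizing x y k with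
  | _ n ih =>
    subst hn
    rcases M.artinTits_eq_one_or x with rfl | ⟨i, x, rfl⟩
    · exact ⟨y, one_dvd y, dvd_rfl, fun _ _ h ↦ h⟩
    rcases M.artinTits_eq_one_or y with rfl | ⟨j, y, rfl⟩
    · exact ⟨_, dvd_rfl, one_dvd _, fun _ h _ ↦ h⟩
    have hik := (dvd_mul_right (M.artinTitsGen i) x).trans hx
    have hjk := (dvd_mul_right (M.artinTitsGen j) y).trans hy
    obtain ⟨_, ⟨u, rfl⟩, ⟨v, hv⟩, hmin⟩ := M.exists_isRightLcm_gen hik hjk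
    obtain ⟨z, rfl⟩ := hmin k hik hjk
    have hlen := M.toAdd_artinTitsLength_mul (M.artinTitsGen i) (u * z)
    have hlen' := M.toAdd_artinTitsLength_mul (M.artinTitsGen j) (v * z)
    have hlenz := M.toAdd_artinTitsLength_mul u z
    rw [artinTitsLength_gen, toAdd_ofAdd, ← mul_assoc] at hlen
    rw [artinTitsLength_gen, toAdd_ofAdd, ← mul_assoc, ← hv] at hlen'
    have hxu : x ∣ u * z := by
      rw [mul_assoc] at hx
      exact dvd_of_mul_dvd_mul_left hx
    have hyv : y ∣ v * z := by
      rw [hv, mul_assoc] at hy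
      exact dvd_of_mul_dvd_mul_left hy
    -- A grid of lcms: `u * q` for `x` and `u`, `v * r` for `y` and `v`, then `d` for `q` and `r`.
    -- The common multiples `u * z`, `v * z` and `z` are all shorter than the original one.
    obtain ⟨_, hxq, ⟨q, rfl⟩, hq⟩ := ih _ (by omega) hxu (dvd_mul_right u z) rfl
    obtain ⟨_, hyr, ⟨r, rfl⟩, hr⟩ := ih _ (by omega) hyv (dvd_mul_right v z) rfl
    obtain ⟨d, hqd, hrd, hd⟩ := ih _ (by omega)
      (dvd_of_mul_dvd_mul_left (hq _ hxu (dvd_mul_right u z)))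
      (dvd_of_mul_dvd_mul_left (hr _ hyv (dvd_mul_right v z))) rfl
    refine ⟨M.artinTitsGen i * u * d, ?_, ?_, ?_⟩
    · rw [mul_assoc]
      exact mul_dvd_mul_left _ (hxq.trans (mul_dvd_mul_left _ hqd))
    · rw [hv, mul_assoc]
      exact mul_dvd_mul_left _ (hyr.trans (mul_dvd_mul_left _ hrd))
    · intro k hk hk'
      obtain ⟨w, rfl⟩ := hmin k ((dvd_mul_right _ _).trans hk) ((dvd_mul_right _ _).trans hk')
      apply mul_dvd_mul_left
      apply hd
      · rw [mul_assoc] at hk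
        exact dvd_of_mul_dvd_mul_left (hq _ (dvd_of_mul_dvd_mul_left hk) (dvd_mul_right u w))
      · rw [hv, mul_assoc] at hk'
        exact dvd_of_mul_dvd_mul_left (hr _ (dvd_of_mul_dvd_mul_left hk') (dvd_mul_right v w))

variable {M}

/-- The left factor `f` is removed one generator at a time: `s` is replaced by its complement `t` in
the lcm with that generator, and `t` stays in `F` by the two closure properties. -/
theorem dvd_mul_of_forall_dvd {F : Set M.ArtinTitsMonoid} (hS : atoms M.ArtinTitsMonoid ⊆ F)
    (hl : ClosedUnderRightLcm F) (hd : ClosedUnderRightDivisor F) {a k : M.ArtinTitsMonoid}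
    (hk : ∀ s ∈ F, s ∣ k → s ∣ a) (f : M.ArtinTitsMonoid) {s : M.ArtinTitsMonoid} (hs : s ∈ F)
    (h : s ∣ f * k) : s ∣ f * a := by
  obtain ⟨ω, rfl⟩ := M.artinTitsWord_surjective f
  induction ω generalizing s with
  | nil =>
    rw [M.artinTitsWord_nil, one_mul] at h ⊢
    exact hk s hs h
  | cons i ω ih =>
    rw [M.artinTitsWord_cons, mul_assoc] at h ⊢
    obtain ⟨_, hh⟩ := M.exists_isRightLcm h (dvd_mul_right (M.artinTitsGen i) _)
    obtain ⟨t, rfl⟩ := hh.2.1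
    have ht := hd _ (hl _ hs _ (hS (M.artinTitsGen_mem_atoms i)) _ hh) t ⟨_, rfl⟩
    exact hh.1.trans (mul_dvd_mul_left _
      (ih ht (dvd_of_mul_dvd_mul_left (hh.2.2 _ h (dvd_mul_right _ _)))))

/-- In an Artin–Tits monoid, a finite set that contains `1` and the atoms and is closed under
right-lcm and right-divisor is a Garside family. -/
theorem isGarsideFamily_of_finite {F : Set M.ArtinTitsMonoid} (hfin : F.Finite) (h1 : 1 ∈ F)
    (hS : atoms M.ArtinTitsMonoid ⊆ F) (hl : ClosedUnderRightLcm F)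
    (hd : ClosedUnderRightDivisor F) : IsGarsideFamily F := by
  refine ⟨h1, fun g ↦ ?_⟩
  induction hn : (M.artinTitsLength g).toAdd using Nat.strong_induction_on generalizing g with
  | _ n ih =>
    subst hn
    rcases M.artinTits_eq_one_or g with rfl | ⟨i, g₁, hg₁⟩
    · exact ⟨[], rfl, by simp, .nil⟩
    obtain ⟨a, haF, ⟨g', rfl⟩, ha⟩ :=
      hl.exists_greatest_dvd (fun _ _ _ ↦ M.exists_isRightLcm) hfin h1 g
    -- The greatest divisor `a` is a multiple of a generator, so the remaining factor `g'` is
    -- strictly shorter.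
    obtain ⟨b, rfl⟩ := ha _ (hS (M.artinTitsGen_mem_atoms i)) ⟨g₁, hg₁⟩
    have hlen := M.toAdd_artinTitsLength_mul (M.artinTitsGen i * b) g'
    rw [toAdd_artinTitsLength_mul _ _ b, artinTitsLength_gen, toAdd_ofAdd] at hlen
    obtain ⟨l, rfl, hlF, hlc⟩ := ih _ (by omega) g' rfl
    refine ⟨_ :: l, List.prod_cons, by simpa using ⟨haF, hlF⟩, ?_⟩
    cases l with
    | nil => exact .singleton _
    | cons c l =>
      refine List.isChain_cons_cons.mpr ⟨fun s hs f hsf ↦ ?_, hlc⟩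
      refine dvd_mul_of_forall_dvd hS hl hd ha f hs (hsf.trans ?_)
      rw [mul_assoc, List.prod_cons, ← mul_assoc _ c]
      exact mul_dvd_mul_left _ (dvd_mul_right _ _)

end CoxeterMatrix

theorem corollary2p3 {B : Type*} (m : CoxeterMatrix B) :
    (∃ F : Set m.ArtinTitsMonoid, F.Finite ∧ Garside.IsGarsideFamily F) ↔
      (Garside.rightClosure (Garside.atoms m.ArtinTitsMonoid)).Finite := by
  have hM (f g : m.ArtinTitsMonoid) : f ∣ g → g ∣ f → f = g := m.eq_of_dvd_of_dvd
  constructor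
  · rintro ⟨F, hfin, hF⟩
    exact hfin.subset (hF.rightClosure_subset hM)
  · intro h
    refine ⟨_, h.insert 1, CoxeterMatrix.isGarsideFamily_of_finite (h.insert 1)
      (Set.mem_insert _ _) ?_ ?_ ?_⟩
    · exact (Garside.subset_rightClosure _).trans (Set.subset_insert _ _)
    · exact (Garside.closedUnderRightLcm_rightClosure _).insert_one hM
    · exact (Garside.closedUnderRightDivisor_rightClosure _).insert_one hM
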